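/- Let $n\ge 2$. (1) Let $B=B(0,\rho)\subset\mathbb C^n$ be an open Euclidean ball with centre $0$ and radius $\rho>0$, and let $X=\sum_i X_i\,\partial/\partial z_i$ be a holomorphic vector field on $B$ that has an isolated zero at $0$ (that is, $X(0)=0$ and $X(z)\ne 0$ for all $z\neq 0$ close to $0$). Suppose that every trajectory of $X$ in $B$ (every holomorphic solution $\varphi:T\to B$ of $\varphi'=X\circ\varphi$ on a connected open set $T\subset\mathbb C$) is contained in an affine complex line. Then $X$ defines the radial foliation at $0$: there is a holomorphic function $u$ on $B$ with $$X=u\cdot\sum_{i=1}^n z_i\frac{\partial}{\partial z_i}\quad\text{on } B ,$$ and $u(0)\neq 0$, so that $u$ is a unit near $0$; moreover $u(z)\ne 0$ at every $z\in B$ with $X(z)\neq0$, so that $u$ is a unit on $B$ if $0$ is the only zero of $X$. (2) Let $X=\sum_i P_i\,\partial/\partial z_i$ be a polynomial vector field on $\mathbb C^n$ with $\gcd(P_1,\dots,P_n)=1$ that defines a foliation by lines, i.e. the leaf through every point where $X\ne0$ is contained in an affine complex line. If $p\in\mathbb C^n$ is an isolated zero of $X$, then the foliation is radial at $p$: there is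 $c\in\mathbb C\setminus\{0\}$ with $$P_i=c\,(z_i-p_i)\qquad (i=1,\dots,n).$$ (3) Let $\mathcal D$ be an algebraic (singular) foliation of dimension one of $\mathbb{CP}(n)$, i.e. a polynomial vector field without common factor of its components in each of the standard affine charts, such that on overlaps of charts these fields have the same zeros (the singular points of $\mathcal D$) and the same tangent lines. Suppose that $\mathcal D$ is a foliation by lines, i.e. the leaf through every regular point is contained in a projective line. If $p$ is an isolated singular point of $\mathcal D$, then $\mathcal D$ is radial at $p$, i.e. it is the pencil of lines through $p$: the point $p$ is the only singular point of $\mathcal D$, and at every $m\ne p$ the projective line tangent to $\mathcal D$ is the line joining $m$ and $p$. Here the leaf through $m$ is the set of points that can be joined to $m$ by a finite chain of (complex-time) trajectories of the vector field, respectively of the vector fields of the charts. -/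

import Mathlib

open scoped LinearAlgebra.Projectivization Topology

/-- `φ`, restricted to the connected open set `T` of complex times, is a trajectory in `U` of the
vector field `X`: it takes its values in `U` and satisfies `φ' = X ∘ φ`. -/
def IsTrajectory {E : Type*} [NormedAddCommGroup E] [NormedSpace ℂ E]
    (X : E → E) (U : Set E) (T : Set ℂ) (φ : ℂ → E) : Prop :=
  IsOpen T ∧ IsConnected T ∧ ∀ t ∈ T, φ t ∈ U ∧ HasDerivAt φ (X (φ t)) t

/-- An affine complex line. -/
def IsComplexLine {E : Type*} [AddCommGroup E] [Module ℂ E] (D : AffineSubspace ℂ E) : Prop :=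
  Module.finrank ℂ D.direction = 1

/-- Every trajectory of `X` in `U` is contained in a complex line. -/
def TrajectoriesInLines {E : Type*} [NormedAddCommGroup E] [NormedSpace ℂ E]
    (X : E → E) (U : Set E) : Prop :=
  ∀ (T : Set ℂ) (φ : ℂ → E), IsTrajectory X U T φ →
    ∃ D : AffineSubspace ℂ E, IsComplexLine D ∧ ∀ t ∈ T, φ t ∈ D

/-- `p` is an isolated zero of the vector field `X`. -/
def IsIsolatedZero {E : Type*} [TopologicalSpace E] [Zero E] (X : E → E) (p : E) : Prop :=
  X p = 0 ∧ ∀ᶠ z in 𝓝[≠] p, X z ≠ 0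

/-- The vector field on `ℂⁿ` whose components are the polynomials `P i`. -/
noncomputable def polyField {n : ℕ} (P : Fin n → MvPolynomial (Fin n) ℂ) (z : Fin n → ℂ) :
    Fin n → ℂ :=
  fun i => MvPolynomial.eval z (P i)

/-- The greatest common divisor of the components is `1` (in other words, the singular set
has codimension at least two). -/
def NoCommonFactor {n : ℕ} (P : Fin n → MvPolynomial (Fin n) ℂ) : Prop :=
  ∀ g : MvPolynomial (Fin n) ℂ, (∀ i, g ∣ P i) → IsUnit g

/-- The leaf through `m` of the foliation of `ℂⁿ` generated by the polynomial vector field `P`: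
the points that can be joined to `m` by a finite chain of trajectories. -/
def affineLeaf {n : ℕ} (P : Fin n → MvPolynomial (Fin n) ℂ) (m : Fin n → ℂ) :
    Set (Fin n → ℂ) :=
  {m' | Relation.ReflTransGen
    (fun a b => ∃ (T : Set ℂ) (φ : ℂ → Fin n → ℂ), IsTrajectory (polyField P) Set.univ T φ ∧
      a ∈ φ '' T ∧ b ∈ φ '' T) m m'}

/-- `P` defines an (algebraic, singular, one-dimensional) foliation by lines of `ℂⁿ`: its
components have no common factor, and the leaf through every regular point is contained in
a line. -/
def IsAffineFoliationByLines {n : ℕ} (P : Fin n → MvPolynomial (Fin n) ℂ) : Prop :=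
  NoCommonFactor P ∧ ∀ m : Fin n → ℂ, polyField P m ≠ 0 →
    ∃ D : AffineSubspace ℂ (Fin n → ℂ), IsComplexLine D ∧ ∀ m' ∈ affineLeaf P m, m' ∈ D

/-- Homogeneous coordinates of the point with coordinates `z` in the `j`-th affine chart of
`ℂP(n)`: a coordinate `1` is inserted at place `j`. -/
noncomputable def chartVec {n : ℕ} (j : Fin (n + 1)) (z : Fin n → ℂ) : Fin (n + 1) → ℂ :=
  Fin.insertNth (α := fun _ => ℂ) j 1 z

/-- The derivative of `chartVec j`: a coordinate `0` is inserted at place `j`. -/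
noncomputable def chartDir {n : ℕ} (j : Fin (n + 1)) (v : Fin n → ℂ) : Fin (n + 1) → ℂ :=
  Fin.insertNth (α := fun _ => ℂ) j 0 v

theorem chartVec_ne_zero {n : ℕ} (j : Fin (n + 1)) (z : Fin n → ℂ) : chartVec j z ≠ 0 := by
  intro h
  have h1 := congrFun h j
  simp [chartVec] at h1

/-- The point of `ℂP(n)` with coordinates `z` in the `j`-th affine chart. -/
noncomputable def chartPt {n : ℕ} (j : Fin (n + 1)) (z : Fin n → ℂ) : ℙ ℂ (Fin (n + 1) → ℂ) :=
  Projectivization.mk ℂ (chartVec j z) (chartVec_ne_zero j z)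

/-- The linear subspace of `ℂⁿ⁺¹` over the projective subspace that passes through the point
with coordinates `z` in the `j`-th chart and is tangent there to the vector field `P` of that
chart: it is the plane over the tangent projective line if `P` does not vanish at `z`, and the
line over the point itself if `P` vanishes at `z`. -/
noncomputable def tangentSpan {n : ℕ} (j : Fin (n + 1)) (P : Fin n → MvPolynomial (Fin n) ℂ)
    (z : Fin n → ℂ) : Submodule ℂ (Fin (n + 1) → ℂ) :=
  Submodule.span ℂ {chartVec j z, chartDir j (polyField P z)}

/-- An (algebraic, singular) foliation of dimension one of `ℂP(n)`: in each of the standard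
affine charts a polynomial vector field without common factor of its components, such that
two of these fields have the same zeros and the same tangent lines on the overlap of their
charts. -/
structure ProjFoliation (n : ℕ) where
  field : Fin (n + 1) → Fin n → MvPolynomial (Fin n) ℂ
  noCommonFactor : ∀ j, NoCommonFactor (field j)
  compatible : ∀ (j k : Fin (n + 1)) (z w : Fin n → ℂ), chartPt j z = chartPt k w →
    tangentSpan j (field j) z = tangentSpan k (field k) w

namespace ProjFoliation

variable {n : ℕ}

/-- The singular set. -/
def sing (F : ProjFoliation n) : Set (ℙ ℂ (Fin (n + 1) → ℂ)) :=
  {m | ∃ (j : Fin (n + 1)) (z : Fin n → ℂ), m = chartPt j z ∧ polyField (F.field j) z = 0}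

/-- `p` is an isolated point of the singular set. Isolatedness is read in an affine chart
around `p`, in which the singular set is the zero set of the vector field of that chart. -/
def IsIsolatedSing (F : ProjFoliation n) (p : ℙ ℂ (Fin (n + 1) → ℂ)) : Prop :=
  ∃ (j : Fin (n + 1)) (z : Fin n → ℂ), p = chartPt j z ∧
    IsIsolatedZero (polyField (F.field j)) z

/-- The leaf through `m`: the points that can be joined to `m` by a finite chain of
trajectories of the vector fields of the affine charts. -/
def leaf (F : ProjFoliation n) (m : ℙ ℂ (Fin (n + 1) → ℂ)) : Set (ℙ ℂ (Fin (n + 1) → ℂ)) :=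
  {m' | Relation.ReflTransGen
    (fun a b => ∃ (j : Fin (n + 1)) (T : Set ℂ) (φ : ℂ → Fin n → ℂ),
      IsTrajectory (polyField (F.field j)) Set.univ T φ ∧
      a ∈ (fun t => chartPt j (φ t)) '' T ∧ b ∈ (fun t => chartPt j (φ t)) '' T) m m'}

/-- Foliation by lines: the leaf through every regular point is contained in a projective
line (given by a two-dimensional linear subspace `W` of `ℂⁿ⁺¹`). -/
def ByLines (F : ProjFoliation n) : Prop :=
  ∀ m : ℙ ℂ (Fin (n + 1) → ℂ), m ∉ F.sing →
    ∃ W : Submodule ℂ (Fin (n + 1) → ℂ), Module.finrank ℂ W = 2 ∧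
      ∀ m' ∈ F.leaf m, m'.submodule ≤ W

/-- The foliation is radial at `p`, that is, it is the pencil of the lines through `p`: the
point `p` is the only singular point, and at every other point `m` the tangent line is the
projective line joining `m` and `p`. -/
def IsRadialAt (F : ProjFoliation n) (p : ℙ ℂ (Fin (n + 1) → ℂ)) : Prop :=
  F.sing = {p} ∧
    ∀ (j : Fin (n + 1)) (z : Fin n → ℂ), chartPt j z ≠ p →
      tangentSpan j (F.field j) z = (chartPt j z).submodule ⊔ p.submodule

end ProjFoliation

/-! A trajectory through a regular point `m` lies in a line, necessarily `m + ℂ X(m)`. By the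
identity theorem `X` is tangent to that line along its whole slice of the ball
(`isParallel_of_regularTrajectoriesInLines`). A limit of the directions `X(z)/‖X(z)‖` as `z → p`
gives an invariant line through the isolated zero `p` (`exists_invariant_direction`).

The key is a Hurwitz-type argument (`eventually_isParallel_sub`). Invariant lines close to this one
carry `X` as a scalar function times a fixed vector. If such a line missed `p`, the scalar would
have no zeros on a disc, large values on its boundary and a small value at its centre, against the
minimum modulus principle. So all these lines pass through `p`. Thus `X(z)` is parallel to `z - p`
on an open set, hence on the ball.

On a ball, the quotient of `X` by the radial field extends across `0` and is nonzero there, since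
for `n ≥ 2` neither singularities nor zeros of holomorphic functions are isolated. For polynomials,
two proportional fields with coprime components differ by a constant. In projective space one chart
is radial by the affine case, and compatibility with coprimality carries the pencil to the other
charts. -/

section Lemmas

open Metric Set Filter

/-! ### Holomorphic differential equations: existence of trajectories -/

/-- A bounded holomorphic map has, on a smaller ball, a Lipschitz constant given by the Schwarz
lemma. -/
theorem dist_le_of_norm_sub_le {E F : Type*} [NormedAddCommGroup E] [NormedSpace ℂ E]
    [NormedAddCommGroup F] [NormedSpace ℂ F] {X : E → F} {z₀ : E} {a : F} {R M : ℝ}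
    (hd : DifferentiableOn ℂ X (ball z₀ (4 * R))) (hM : ∀ z ∈ ball z₀ (4 * R), ‖X z - a‖ ≤ M)
    {x y : E} (hx : x ∈ ball z₀ R) (hy : y ∈ ball z₀ R) :
    dist (X y) (X x) ≤ M / R * dist y x := by
  have hR : 0 < R := nonempty_ball.1 ⟨x, hx⟩
  have hsub : ball x (2 * R) ⊆ ball z₀ (4 * R) := by
    apply ball_subset_ball'
    have := mem_ball.1 hx
    linarith
  -- The ball of radius `2 * R` about `x` contains `y`, and `X` moves its points at most `2 * M`
  -- away from `X x`.
  have h := Complex.dist_le_div_mul_dist_of_mapsTo_ball (f := X) (c := x) (z := y) (R₁ := 2 * R)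
    (R₂ := 2 * M) (hd.mono hsub) (fun w hw => by
      rw [mem_closedBall, dist_eq_norm]
      have h1 := hM w (hsub hw)
      have h2 := hM x (hsub (mem_ball_self (by positivity)))
      calc ‖X w - X x‖ = ‖(X w - a) - (X x - a)‖ := by congr 1; abel
        _ ≤ ‖X w - a‖ + ‖X x - a‖ := norm_sub_le _ _
        _ ≤ 2 * M := by linarith) (by
      rw [mem_ball] at *
      have := dist_triangle_right y x z₀
      linarith)
  rwa [mul_div_mul_left _ _ two_ne_zero] at h

/-- Existence of solutions of a holomorphic differential equation. -/
theorem exists_hasDerivAt_of_differentiableOn {E : Type*} [NormedAddCommGroup E] [NormedSpace ℂ E]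
    [CompleteSpace E] {X : E → E} {U : Set E} (hU : IsOpen U) (hX : DifferentiableOn ℂ X U)
    {z₀ : E} (hz₀ : z₀ ∈ U) :
    ∃ r > 0, ∃ φ : ℂ → E, φ 0 = z₀ ∧
      ∀ t ∈ ball (0 : ℂ) r, φ t ∈ U ∧ HasDerivAt φ (X (φ t)) t := by
  have hcont : ContinuousAt X z₀ := (hX.differentiableAt (hU.mem_nhds hz₀)).continuousAt
  have hev : ∀ᶠ z in 𝓝 z₀, z ∈ U ∧ ‖X z - X z₀‖ ≤ 1 := by
    refine (hU.eventually_mem hz₀).and ?_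
    filter_upwards [hcont (closedBall_mem_nhds (X z₀) one_pos)] with z hz
    simpa [dist_eq_norm] using hz
  obtain ⟨R', hR', hball⟩ := Metric.eventually_nhds_iff_ball.1 hev
  obtain ⟨R, hR, rfl⟩ : ∃ R > 0, R' = 4 * R := ⟨R' / 4, by positivity, by ring⟩
  have hXd : DifferentiableOn ℂ X (ball z₀ (4 * R)) := hX.mono fun z hz => (hball z hz).1
  have hlip : ∀ x ∈ ball z₀ R, ∀ y ∈ ball z₀ R, ‖X y - X x‖ ≤ 1 / R * ‖y - x‖ := by
    intro x hx y hy
    simpa [dist_eq_norm] using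
      dist_le_of_norm_sub_le hXd (a := X z₀) (fun z hz => (hball z hz).2) hx hy
  set M : ℝ := ‖X z₀‖ + 1 with hMdef
  have hM0 : 0 < M := by positivity
  have hsub : ball z₀ R ⊆ ball z₀ (4 * R) := ball_subset_ball (by linarith)
  have hM : ∀ z ∈ ball z₀ R, ‖X z‖ ≤ M := fun z hz => by
    have h1 := (hball z (hsub hz)).2
    have h2 := norm_sub_norm_le (X z) (X z₀)
    linarith
  -- The first bound keeps the Picard iterates in `ball z₀ R`; the second makes the iteration
  -- contract by `1 / 2`.
  obtain ⟨r, hr, hr1, hr2⟩ : ∃ r > 0, M * r < R ∧ 1 / R * r ≤ 1 / 2 := by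
    refine ⟨min (R / (2 * M)) (R / 2), by positivity, ?_, ?_⟩
    · calc M * min (R / (2 * M)) (R / 2) ≤ M * (R / (2 * M)) := by gcongr; exact min_le_left _ _
        _ = R / 2 := by field_simp
        _ < R := by linarith
    · calc 1 / R * min (R / (2 * M)) (R / 2) ≤ 1 / R * (R / 2) := by
            gcongr; exact min_le_right _ _
        _ = 1 / 2 := by field_simp
  let S := {φ : ℂ → E // (∀ t ∈ ball (0 : ℂ) r, DifferentiableAt ℂ φ t ∧ φ t ∈ ball z₀ R) ∧
    φ 0 = z₀}
  -- The Picard operator: holomorphic maps on a disc have primitives, which replace the integral.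
  have hstep : ∀ φ : S, ∃ ψ : S, ∀ t ∈ ball (0 : ℂ) r, HasDerivAt ψ.1 (X (φ.1 t)) t := by
    rintro ⟨φ, hφ, hφ0⟩
    have hd : DifferentiableOn ℂ (fun t => X (φ t)) (ball 0 r) := fun t ht =>
      ((hXd.differentiableAt (isOpen_ball.mem_nhds (hsub (hφ t ht).2))).comp t
        (hφ t ht).1).differentiableWithinAt
    obtain ⟨ψ, hψ0, hψ⟩ := hd.isExactOn_ball.with_val_at 0 z₀
    refine ⟨⟨ψ, fun t ht => ⟨(hψ t ht).differentiableAt, ?_⟩, hψ0⟩, hψ⟩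
    have h := (convex_ball (0 : ℂ) r).norm_image_sub_le_of_norm_hasDerivWithin_le (C := M)
      (fun s hs => (hψ s hs).hasDerivWithinAt) (fun s hs => hM _ (hφ s hs).2)
      (mem_ball_self hr) ht
    rw [hψ0] at h
    rw [mem_ball, dist_eq_norm]
    refine h.trans_lt (lt_of_le_of_lt ?_ hr1)
    have := mem_ball_zero_iff.1 ht
    gcongr
    simpa using this.le
  choose step hstep using hstep
  let φ₀ : S := ⟨fun _ => z₀, fun t _ => ⟨differentiableAt_const _, mem_ball_self hR⟩, rfl⟩
  let s : ℕ → S := fun k => step^[k] φ₀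
  have hs : ∀ k, ∀ t ∈ ball (0 : ℂ) r, HasDerivAt (s (k + 1)).1 (X ((s k).1 t)) t := by
    intro k t ht
    have : s (k + 1) = step (s k) := Function.iterate_succ_apply' step k φ₀
    rw [this]
    exact hstep _ t ht
  have hdist : ∀ k, ∀ t ∈ ball (0 : ℂ) r, ‖(s (k + 1)).1 t - (s k).1 t‖ ≤ R * (1 / 2) ^ k := by
    intro k
    induction k with
    | zero =>
      intro t ht
      have := ((s 1).2.1 t ht).2
      rw [mem_ball, dist_eq_norm] at this
      simpa [s, φ₀] using this.le
    | succ k ih =>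
      intro t ht
      have h := (convex_ball (0 : ℂ) r).norm_image_sub_le_of_norm_hasDerivWithin_le
        (C := 1 / R * (R * (1 / 2) ^ k)) (f := fun t => (s (k + 2)).1 t - (s (k + 1)).1 t)
        (fun w hw => ((hs (k + 1) w hw).sub (hs k w hw)).hasDerivWithinAt)
        (fun w hw => (hlip _ ((s k).2.1 w hw).2 _ ((s (k + 1)).2.1 w hw).2).trans (by
          gcongr; exact ih w hw)) (mem_ball_self hr) ht
      simp only [(s (k + 2)).2.2, (s (k + 1)).2.2, sub_self, sub_zero] at h
      refine h.trans ?_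
      have ht' := (mem_ball_zero_iff.1 ht).le
      calc 1 / R * (R * (1 / 2) ^ k) * ‖t‖ ≤ 1 / R * (R * (1 / 2) ^ k) * r := by gcongr
        _ = R * (1 / 2) ^ k * (1 / R * r) := by ring
        _ ≤ R * (1 / 2) ^ k * (1 / 2) := by gcongr
        _ = R * (1 / 2) ^ (k + 1) := by ring
  have hdist' : ∀ t ∈ ball (0 : ℂ) r, ∀ k,
      dist ((s k).1 t) ((s (k + 1)).1 t) ≤ R * (1 / 2) ^ k := fun t ht k => by
    rw [dist_comm, dist_eq_norm]; exact hdist k t ht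
  have hlim : ∀ t : ℂ, ∃ y : E, t ∈ ball (0 : ℂ) r → Tendsto (fun k => (s k).1 t) atTop (𝓝 y) := by
    intro t
    by_cases ht : t ∈ ball (0 : ℂ) r
    · obtain ⟨y, hy⟩ := cauchySeq_tendsto_of_complete
        (cauchySeq_of_le_geometric (1 / 2) R (by norm_num) (hdist' t ht))
      exact ⟨y, fun _ => hy⟩
    · exact ⟨0, fun h => absurd h ht⟩
  choose φ hφ using hlim
  have hunif : TendstoLocallyUniformlyOn (fun k => (s k).1) φ atTop (ball (0 : ℂ) r) := by
    apply TendstoUniformlyOn.tendstoLocallyUniformlyOn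
    rw [Metric.tendstoUniformlyOn_iff]
    intro ε hε
    have h0 : Tendsto (fun k : ℕ => R * (1 / 2 : ℝ) ^ k / (1 - 1 / 2)) atTop (𝓝 0) := by
      have := (tendsto_pow_atTop_nhds_zero_of_lt_one (r := (1 / 2 : ℝ)) (by norm_num)
        (by norm_num)).const_mul R
      simpa using this.div_const (1 - 1 / 2)
    filter_upwards [h0.eventually_lt_const hε] with k hk t ht
    rw [dist_comm]
    exact (dist_le_of_le_geometric_of_tendsto (1 / 2) R (by norm_num) (hdist' t ht)
      (hφ t ht) k).trans_lt hk
  have hsd : ∀ k, DifferentiableOn ℂ (s k).1 (ball (0 : ℂ) r) := fun k t ht =>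
    ((s k).2.1 t ht).1.differentiableWithinAt
  -- Locally uniform limits of holomorphic maps may be differentiated termwise, so the recursion
  -- passes to the limit.
  have hφd := hunif.differentiableOn (.of_forall hsd) isOpen_ball
  have hderiv := hunif.deriv (.of_forall hsd) isOpen_ball
  have hmem : ∀ t ∈ ball (0 : ℂ) r, φ t ∈ ball z₀ (4 * R) := fun t ht => by
    have : φ t ∈ closedBall z₀ R := isClosed_closedBall.mem_of_tendsto (hφ t ht)
      (.of_forall fun k => ball_subset_closedBall ((s k).2.1 t ht).2)
    exact closedBall_subset_ball (by linarith) this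
  refine ⟨r, hr, φ, ?_, fun t ht => ⟨(hball _ (hmem t ht)).1, ?_⟩⟩
  · refine tendsto_nhds_unique (hφ 0 (mem_ball_self hr)) ?_
    simp only [fun k => (s k).2.2, tendsto_const_nhds]
  · have hda := (hφd.differentiableAt (isOpen_ball.mem_nhds ht)).hasDerivAt
    convert hda using 1
    have h1 : Tendsto (fun k => deriv (s (k + 1)).1 t) atTop (𝓝 (deriv φ t)) :=
      (hderiv.tendsto_at ht).comp (tendsto_add_atTop_nat 1)
    have h2 : Tendsto (fun k => X ((s k).1 t)) atTop (𝓝 (X (φ t))) :=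
      ((hXd.differentiableAt (isOpen_ball.mem_nhds (hmem t ht))).continuousAt.tendsto).comp (hφ t ht)
    refine tendsto_nhds_unique h2 (h1.congr fun k => (hs k t ht).deriv)

/-! ### Minimum modulus and identity theorem -/

/-- Minimum modulus principle for holomorphic functions without zeros. -/
theorem le_norm_of_forall_sphere_le_norm {h : ℂ → ℂ} {c : ℂ} {r δ : ℝ} (hr : 0 < r) (hδ : 0 < δ)
    (hd : DiffContOnCl ℂ h (ball c r)) (h0 : ∀ s ∈ closedBall c r, h s ≠ 0)
    (hs : ∀ s ∈ sphere c r, δ ≤ ‖h s‖) : δ ≤ ‖h c‖ := by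
  have hinv : DiffContOnCl ℂ (h⁻¹) (ball c r) :=
    hd.inv fun s hs => h0 s (by rwa [closure_ball _ hr.ne'] at hs)
  have := Complex.norm_le_of_forall_mem_frontier_norm_le isBounded_ball hinv (C := δ⁻¹)
    (fun s hs' => by
      rw [frontier_ball _ hr.ne'] at hs'
      rw [Pi.inv_apply, norm_inv]
      exact inv_anti₀ hδ (hs s hs')) (subset_closure (mem_ball_self hr))
  rw [Pi.inv_apply, norm_inv] at this
  exact (inv_le_inv₀ (norm_pos_iff.2 (h0 c (mem_closedBall_self hr.le))) hδ).1 this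

/-- A holomorphic map on a convex open set that vanishes near a point vanishes identically. -/
theorem eqOn_zero_of_eventuallyEq_zero_of_convex {E F : Type*} [NormedAddCommGroup E]
    [NormedSpace ℂ E] [NormedAddCommGroup F] [NormedSpace ℂ F] [CompleteSpace F] {G : E → F}
    {U : Set E} (hU : IsOpen U) (hc : Convex ℝ U) (hG : DifferentiableOn ℂ G U) {z₀ : E}
    (hz₀ : z₀ ∈ U) (h : ∀ᶠ z in 𝓝 z₀, G z = 0) : ∀ z ∈ U, G z = 0 := by
  intro w hw
  -- The slice of `U` by the complex line through `z₀` and `w` is convex, so the one-variable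
  -- identity theorem applies.
  let γ : ℂ → E := fun s => z₀ + s • (w - z₀)
  have hγ : Differentiable ℂ γ := by fun_prop
  have hV : IsOpen (γ ⁻¹' U) := hU.preimage hγ.continuous
  have hVc : Convex ℝ (γ ⁻¹' U) := by
    intro a ha b hb α β hα hβ hαβ
    have := hc ha hb hα hβ hαβ
    rw [mem_preimage]
    convert this using 1
    simp only [γ, smul_add, add_smul, smul_assoc]
    rw [show α • z₀ + α • a • (w - z₀) + (β • z₀ + β • b • (w - z₀)) =
      (α + β) • z₀ + (α • a • (w - z₀) + β • b • (w - z₀)) by rw [add_smul]; abel, hαβ, one_smul]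
  have han : AnalyticOnNhd ℂ (G ∘ γ) (γ ⁻¹' U) :=
    (hG.comp hγ.differentiableOn fun s hs => hs).analyticOnNhd hV
  have h0 : (0 : ℂ) ∈ γ ⁻¹' U := by simpa [γ] using hz₀
  have hev : (G ∘ γ) =ᶠ[𝓝 0] 0 := by
    have : Tendsto γ (𝓝 0) (𝓝 z₀) := by
      have := hγ.continuous.tendsto 0
      simpa [γ] using this
    exact this.eventually h
  have := han.eqOn_zero_of_preconnected_of_eventuallyEq_zero hVc.isPreconnected h0 hev
    (show (1 : ℂ) ∈ γ ⁻¹' U by simpa [γ] using hw)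
  simpa [γ] using this

/-! ### Parallel vectors -/

/-- Two vectors are linearly dependent; the condition is written so as to be closed and
bilinear. -/
def IsParallel {E : Type*} [NormedAddCommGroup E] [NormedSpace ℂ E] (a b : E) : Prop :=
  ∀ ℓ : E →L[ℂ] ℂ, ℓ b • a = ℓ a • b

/-- Every trajectory of `X` in `U` that passes through a regular point is contained in a line. -/
def RegularTrajectoriesInLines {E : Type*} [NormedAddCommGroup E] [NormedSpace ℂ E]
    (X : E → E) (U : Set E) : Prop :=
  ∀ (T : Set ℂ) (φ : ℂ → E), IsTrajectory X U T φ → ∀ t₀ ∈ T, X (φ t₀) ≠ 0 →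
    ∃ D : AffineSubspace ℂ E, IsComplexLine D ∧ ∀ t ∈ T, φ t ∈ D

section Parallel

variable {E : Type*} [NormedAddCommGroup E] [NormedSpace ℂ E]

theorem IsParallel.symm {a b : E} (h : IsParallel a b) : IsParallel b a := fun ℓ => (h ℓ).symm

theorem isParallel_smul_self (c : ℂ) (b : E) : IsParallel (c • b) b := fun ℓ => by
  rw [map_smul, smul_eq_mul, smul_smul, mul_comm]

theorem isParallel_of_mem_of_finrank_eq_one {V : Submodule ℂ E} (hV : Module.finrank ℂ V = 1)
    {a b : E} (ha : a ∈ V) (hb : b ∈ V) : IsParallel a b := by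
  obtain ⟨v, -, hv⟩ := finrank_eq_one_iff'.1 hV
  obtain ⟨x, hx⟩ := hv ⟨a, ha⟩
  obtain ⟨y, hy⟩ := hv ⟨b, hb⟩
  have hx' : x • (v : E) = a := congrArg Subtype.val hx
  have hy' : y • (v : E) = b := congrArg Subtype.val hy
  intro ℓ
  rw [← hx', ← hy']
  simp only [map_smul, smul_eq_mul, smul_smul]
  ring_nf

theorem IsParallel.eq_smul {a b : E} (h : IsParallel a b) {ℓ : E →L[ℂ] ℂ} (hℓ : ℓ b ≠ 0) :
    a = (ℓ a / ℓ b) • b := by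
  rw [div_eq_inv_mul, mul_smul, ← h ℓ, smul_smul, inv_mul_cancel₀ hℓ, one_smul]

theorem exists_clm_apply_eq_one {b : E} (hb : b ≠ 0) : ∃ ℓ : E →L[ℂ] ℂ, ℓ b = 1 := by
  obtain ⟨g, hg⟩ := SeparatingDual.exists_eq_one (R := ℂ) hb
  exact ⟨g, hg⟩

/-- The zero vector is parallel to everything, so the middle vector has to be nonzero. -/
theorem IsParallel.trans {a b c : E} (hab : IsParallel a b) (hbc : IsParallel b c) (hb : b ≠ 0) :
    IsParallel a c := by
  obtain ⟨ℓ, hℓ⟩ := exists_clm_apply_eq_one hb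
  rw [hab.eq_smul (ℓ := ℓ) (by simp [hℓ])]
  intro k
  rw [smul_comm, hbc k, smul_smul, map_smul, smul_eq_mul]

theorem isParallel_of_tendsto {α : Type*} {f : Filter α} [f.NeBot] {x y : α → E} {a b : E}
    (hx : Tendsto x f (𝓝 a)) (hy : Tendsto y f (𝓝 b)) (h : ∀ᶠ i in f, IsParallel (x i) (y i)) :
    IsParallel a b := fun ℓ =>
  tendsto_nhds_unique_of_eventuallyEq (((ℓ.continuous.tendsto b).comp hy).smul hx)
    (((ℓ.continuous.tendsto a).comp hx).smul hy) (h.mono fun _ hi => hi ℓ)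

end Parallel

/-! ### Radiality at an isolated zero -/

section Field

variable {E : Type*} [NormedAddCommGroup E] [NormedSpace ℂ E] {X : E → E} {p : E} {ρ : ℝ}

/-- The field is tangent to the line that is tangent to it at one point. -/
theorem isParallel_of_regularTrajectoriesInLines [FiniteDimensional ℂ E]
    (hX : DifferentiableOn ℂ X (ball p ρ))
    (hT : RegularTrajectoriesInLines X (ball p ρ)) {m : E} (hm : m ∈ ball p ρ) {s : ℂ}
    (hs : m + s • X m ∈ ball p ρ) : IsParallel (X (m + s • X m)) (X m) := by
  have : CompleteSpace E := FiniteDimensional.complete ℂ E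
  by_cases hm0 : X m = 0
  · intro ℓ; simp [hm0]
  obtain ⟨r, hr, φ, hφ0, hφ⟩ := exists_hasDerivAt_of_differentiableOn isOpen_ball hX hm
  have h0r : (0 : ℂ) ∈ ball (0 : ℂ) r := mem_ball_self hr
  obtain ⟨D, hD, hDφ⟩ := hT (ball 0 r) φ
    ⟨isOpen_ball, (convex_ball (0 : ℂ) r).isConnected ⟨0, h0r⟩, hφ⟩ 0 h0r (by rwa [hφ0])
  have hclosed : IsClosed (D.direction : Set E) := D.direction.closed_of_finiteDimensional
  have hdir : ∀ t ∈ ball (0 : ℂ) r, φ t - m ∈ D.direction := fun t ht => by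
    rw [← hφ0]; exact D.vsub_mem_direction (hDφ t ht) (hDφ 0 h0r)
  have hXdir : ∀ t ∈ ball (0 : ℂ) r, X (φ t) ∈ D.direction := fun t ht => by
    have h := hasDerivAt_iff_tendsto_slope.1 (hφ t ht).2
    refine hclosed.mem_of_tendsto h ?_
    filter_upwards [nhdsWithin_le_nhds (isOpen_ball.mem_nhds ht)] with w hw
    rw [slope_def_module]
    exact D.direction.smul_mem _ (D.vsub_mem_direction (hDφ w hw) (hDφ t ht))
  have hXm : X m ∈ D.direction := by simpa [hφ0] using hXdir 0 h0r
  obtain ⟨k, hk⟩ := exists_clm_apply_eq_one hm0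
  -- The coordinate of the trajectory on the line `m + ℂ X(m)`; its derivative at `0` is `1`.
  let σ : ℂ → ℂ := fun t => k (φ t - m)
  have hσ : ∀ t ∈ ball (0 : ℂ) r, φ t = m + σ t • X m := fun t ht => by
    have := (isParallel_of_mem_of_finrank_eq_one hD (hdir t ht) hXm).eq_smul (ℓ := k) (by simp [hk])
    rw [hk, div_one] at this
    rw [← this]; abel
  have hσd : HasDerivAt σ 1 0 := by
    have h1 := (hφ 0 h0r).2
    rw [hφ0] at h1
    have := k.hasFDerivAt.comp_hasDerivAt (0 : ℂ) (h1.sub_const m)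
    rwa [hk] at this
  let γ : ℂ → E := fun s => m + s • X m
  have hγ : Differentiable ℂ γ := by fun_prop
  have hV : IsOpen (γ ⁻¹' ball p ρ) := isOpen_ball.preimage hγ.continuous
  have hVc : Convex ℝ (γ ⁻¹' ball p ρ) := by
    intro a ha b hb α β hα hβ hαβ
    have := convex_ball p ρ ha hb hα hβ hαβ
    rw [mem_preimage]
    convert this using 1
    simp only [γ, smul_add, add_smul, smul_assoc]
    rw [show α • m + α • a • X m + (β • m + β • b • X m) =
      (α + β) • m + (α • a • X m + β • b • X m) by rw [add_smul]; abel, hαβ, one_smul]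
  have h0 : (0 : ℂ) ∈ γ ⁻¹' ball p ρ := by
    change m + (0 : ℂ) • X m ∈ ball p ρ
    simpa using hm
  intro ℓ
  let G : ℂ → E := fun s => ℓ (X m) • X (γ s) - ℓ (X (γ s)) • X m
  have hXγ : DifferentiableOn ℂ (fun s => X (γ s)) (γ ⁻¹' ball p ρ) :=
    hX.comp hγ.differentiableOn fun s hs => hs
  have hG : AnalyticOnNhd ℂ G (γ ⁻¹' ball p ρ) := by
    refine DifferentiableOn.analyticOnNhd ?_ hV
    exact (hXγ.const_smul _).sub
      ((ℓ.differentiable.comp_differentiableOn hXγ).smul_const _)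
  -- Since `σ' 0 ≠ 0`, the values `σ t` are nonzero and accumulate at `0`; there `γ` meets the
  -- trajectory, to which `X` is tangent.
  have hfreq : ∃ᶠ s in 𝓝[≠] (0 : ℂ), G s = 0 := by
    have ht := hσd.tendsto_nhdsNE one_ne_zero
    have hσ0 : σ 0 = 0 := by simp [σ, hφ0]
    rw [hσ0] at ht
    refine ht.frequently (Eventually.frequently ?_)
    filter_upwards [nhdsWithin_le_nhds (isOpen_ball.mem_nhds h0r)] with t ht
    have : γ (σ t) = φ t := (hσ t ht).symm
    simp only [G, this]
    rw [isParallel_of_mem_of_finrank_eq_one hD (hXdir t ht) hXm ℓ, sub_self]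
  have := hG.eqOn_zero_of_preconnected_of_frequently_eq_zero hVc.isPreconnected h0 hfreq
    (show s ∈ γ ⁻¹' ball p ρ from hs)
  exact sub_eq_zero.1 this

/-- Some line through an isolated zero is invariant. -/
theorem exists_invariant_direction [FiniteDimensional ℂ E] [Nontrivial E] (hρ : 0 < ρ)
    (hX : DifferentiableOn ℂ X (ball p ρ))
    (hpar : ∀ m ∈ ball p ρ, ∀ s : ℂ, m + s • X m ∈ ball p ρ → IsParallel (X (m + s • X m)) (X m))
    (hp : ∀ᶠ z in 𝓝[≠] p, X z ≠ 0) :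
    ∃ v : E, ‖v‖ = 1 ∧ ∀ s : ℂ, p + s • v ∈ ball p ρ → IsParallel (X (p + s • v)) v := by
  have : ProperSpace E := FiniteDimensional.proper ℂ E
  have : (𝓝[≠] p).NeBot := Module.punctured_nhds_neBot ℂ E p
  -- Along an ultrafilter the unit directions converge, by compactness of the sphere, without
  -- choosing a subsequence.
  let f : Ultrafilter E := Ultrafilter.of (𝓝[≠] p)
  have hf : (f : Filter E) ≤ 𝓝[≠] p := Ultrafilter.of_le _
  let V : E → E := fun z => (‖X z‖ : ℂ)⁻¹ • X z
  have hVs : ∀ᶠ z in (f : Filter E), V z ∈ sphere (0 : E) 1 := by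
    filter_upwards [hf hp] with z hz
    have : ‖X z‖ ≠ 0 := norm_ne_zero_iff.2 hz
    simp [V, norm_smul, this]
  obtain ⟨v, hv, hlim⟩ := (isCompact_sphere (0 : E) 1).ultrafilter_le_nhds' (f.map V) hVs
  have hlim : Tendsto V f (𝓝 v) := hlim
  have hid : Tendsto id (f : Filter E) (𝓝 p) := hf.trans nhdsWithin_le_nhds
  refine ⟨v, by simpa using hv, fun s hs => ?_⟩
  have hl : Tendsto (fun z => z + s • V z) f (𝓝 (p + s • v)) := hid.add (hlim.const_smul s)
  have hXc : ContinuousAt X (p + s • v) :=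
    (hX.differentiableAt (isOpen_ball.mem_nhds hs)).continuousAt
  refine isParallel_of_tendsto (hXc.tendsto.comp hl) hlim ?_
  filter_upwards [hl (isOpen_ball.mem_nhds hs), hid (ball_mem_nhds p hρ), hf hp] with z h1 h2 h3
  have e : z + s • V z = z + (s * (‖X z‖ : ℂ)⁻¹) • X z := by simp [V, smul_smul]
  have hz : z + s • V z ∈ ball p ρ := h1
  rw [e] at hz
  change IsParallel (X (z + s • V z)) (V z)
  rw [e]
  exact (hpar z h2 _ hz).trans (isParallel_smul_self _ _).symm h3

/-- The lines near an invariant line through the isolated zero also pass through that zero. -/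
theorem eventually_isParallel_sub (hX : DifferentiableOn ℂ X (ball p ρ))
    (hpar : ∀ m ∈ ball p ρ, ∀ s : ℂ, m + s • X m ∈ ball p ρ → IsParallel (X (m + s • X m)) (X m))
    (hp0 : X p = 0) {R : ℝ} (hR : 3 * R < ρ) (hreg : ∀ z ∈ ball p (3 * R), z ≠ p → X z ≠ 0)
    {v : E} (hv : ‖v‖ = R) (hR0 : 0 < R)
    (hinv : IsParallel (X (p + v)) v) : ∀ᶠ z in 𝓝 (p + v), IsParallel (X z) (z - p) := by
  have hsub : ball p (3 * R) ⊆ ball p ρ := ball_subset_ball hR.le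
  have hv0 : v ≠ 0 := norm_pos_iff.1 (by rwa [hv])
  have hz₀ : p + v ∈ ball p (3 * R) := by
    rw [mem_ball, dist_eq_norm, add_sub_cancel_left, hv]; linarith
  have hXz₀ : X (p + v) ≠ 0 := hreg _ hz₀ (by simpa using hv0)
  obtain ⟨k, hk⟩ := exists_clm_apply_eq_one hv0
  have hXc : ∀ z ∈ ball p (3 * R), ContinuousAt X z := fun z hz =>
    (hX.differentiableAt (isOpen_ball.mem_nhds (hsub hz))).continuousAt
  set c := k (X (p + v)) with hc
  have hcv : X (p + v) = c • v := by
    have := hinv.eq_smul (ℓ := k) (by simp [hk])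
    rwa [hk, div_one] at this
  have hc0 : c ≠ 0 := by rintro h; rw [h, zero_smul] at hcv; exact hXz₀ hcv
  -- The line through `z` in direction `X z`, normalised so that `s = 1` gives `z` and so that for
  -- `z = p + v` it is `p + s • v`, with `p` at `s = 0`.
  let l : E × ℂ → E := fun q => q.1 + ((q.2 - 1) * c⁻¹) • X q.1
  have hl₀ : ∀ s, l (p + v, s) = p + s • v := fun s => by
    simp only [l, hcv, smul_smul]
    rw [mul_assoc, inv_mul_cancel₀ hc0, mul_one, sub_smul, one_smul]; abel
  have hlc : ∀ s, ContinuousAt l (p + v, s) := fun s => by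
    have h1 : ContinuousAt (fun q : E × ℂ => X q.1) (p + v, s) :=
      ContinuousAt.comp (f := Prod.fst) (hXc _ hz₀) continuousAt_fst
    exact continuousAt_fst.add (ContinuousAt.smul (by fun_prop) h1)
  have hlmem : ∀ s ∈ closedBall (0 : ℂ) 1, l (p + v, s) ∈ ball p (3 * R) := fun s hs => by
    rw [hl₀, mem_ball, dist_eq_norm, add_sub_cancel_left, norm_smul, hv]
    have := mem_closedBall_zero_iff.1 hs
    nlinarith
  have hcompact : ∀ᶠ z in 𝓝 (p + v), ∀ s ∈ closedBall (0 : ℂ) 1, l (z, s) ∈ ball p (3 * R) :=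
    (isCompact_closedBall (0 : ℂ) 1).eventually_forall_of_forall_eventually fun s hs =>
      (hlc s).eventually (isOpen_ball.mem_nhds (hlmem s hs))
  have hXl : ∀ s ∈ closedBall (0 : ℂ) 1, ContinuousAt (fun q => ‖X (l q)‖) (p + v, s) :=
    fun s hs => ((hXc _ (hlmem s hs)).comp (hlc s)).norm
  obtain ⟨δ, hδ, hδs⟩ : ∃ δ > 0, ∀ s ∈ sphere (0 : ℂ) 1, δ < ‖X (l (p + v, s))‖ := by
    have hne : ∀ s ∈ sphere (0 : ℂ) 1, 0 < ‖X (l (p + v, s))‖ := fun s hs => by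
      rw [norm_pos_iff]
      refine hreg _ (hlmem s (sphere_subset_closedBall hs)) ?_
      rw [hl₀]
      have : s ≠ 0 := by rintro rfl; simp at hs
      simp [this, hv0]
    have hcs : ContinuousOn (fun s => ‖X (l (p + v, s))‖) (sphere (0 : ℂ) 1) := fun s hs =>
      (ContinuousAt.comp (f := fun s : ℂ => (p + v, s)) (hXl s (sphere_subset_closedBall hs))
        (by fun_prop)).continuousWithinAt
    obtain ⟨s, hs, hmin⟩ := (isCompact_sphere (0 : ℂ) 1).exists_isMinOn
      (NormedSpace.sphere_nonempty.2 zero_le_one) hcs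
    refine ⟨‖X (l (p + v, s))‖ / 2, half_pos (hne s hs), fun w hw => ?_⟩
    exact (half_lt_self (hne s hs)).trans_le (hmin hw)
  have hsphere : ∀ᶠ z in 𝓝 (p + v), ∀ s ∈ sphere (0 : ℂ) 1, δ < ‖X (l (z, s))‖ :=
    (isCompact_sphere (0 : ℂ) 1).eventually_forall_of_forall_eventually fun s hs =>
      (hXl s (sphere_subset_closedBall hs)).eventually (lt_mem_nhds (hδs s hs))
  have hcentre : ∀ᶠ z in 𝓝 (p + v), ‖X (l (z, 0))‖ < δ := by
    have h1 : ContinuousAt (fun z : E => ‖X (l (z, 0))‖) (p + v) :=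
      ContinuousAt.comp (f := fun z : E => (z, (0 : ℂ))) (hXl 0 (by simp)) (by fun_prop)
    refine h1.eventually (gt_mem_nhds ?_)
    simpa [hl₀, hp0] using hδ
  filter_upwards [hcompact, hsphere, hcentre, isOpen_ball.mem_nhds hz₀,
    (hXc _ hz₀).eventually_ne hXz₀] with z h1 h2 h3 h4 h5
  by_contra hcon
  -- A zero of `X` on this disc could only be `p`, and then `z - p` would be a multiple of `X z`.
  have hlz : ∀ s ∈ closedBall (0 : ℂ) 1, X (l (z, s)) ≠ 0 := by
    intro s hs h
    have hlp : l (z, s) = p := by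
      by_contra hne
      exact hreg _ (h1 s hs) hne h
    apply hcon
    have : z - p = -((s - 1) * c⁻¹) • X z := by
      rw [neg_smul, ← hlp]; simp only [l]; abel
    rw [this]
    exact (isParallel_smul_self _ _).symm
  obtain ⟨ℓ, hℓ⟩ := exists_clm_apply_eq_one h5
  have hμ : ∀ s ∈ closedBall (0 : ℂ) 1, X (l (z, s)) = ℓ (X (l (z, s))) • X z := fun s hs => by
    have := (hpar z (hsub h4) _ (hsub (h1 s hs))).eq_smul (ℓ := ℓ) (by simp [hℓ])
    rwa [hℓ, div_one] at this
  have hn : 0 < ‖X z‖ := norm_pos_iff.2 h5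
  have hdl : Differentiable ℂ fun s => l (z, s) := by
    simp only [l]; fun_prop
  have hdd : DifferentiableOn ℂ (fun s => ℓ (X (l (z, s)))) (closedBall 0 1) := fun s hs =>
    (ℓ.differentiableAt.comp s ((hX.differentiableAt (isOpen_ball.mem_nhds (hsub (h1 s hs)))).comp
      s (hdl s))).differentiableWithinAt
  -- The bound on the circle would hold at the centre too, contradicting `h3`.
  have hle := le_norm_of_forall_sphere_le_norm (h := fun s => ℓ (X (l (z, s)))) (c := 0) (r := 1)
    (δ := δ / ‖X z‖) one_pos (by positivity)
    (DifferentiableOn.diffContOnCl (by rwa [closure_ball _ one_ne_zero]))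
    (fun s hs h => hlz s hs (by rw [hμ s hs, h, zero_smul]))
    (fun s hs => by
      rw [div_le_iff₀ hn, ← norm_smul, ← hμ s (sphere_subset_closedBall hs)]
      exact (h2 s hs).le)
  rw [div_le_iff₀ hn, ← norm_smul, ← hμ 0 (by simp)] at hle
  linarith

/-- A vector field with an isolated zero whose trajectories lie in lines is radial. -/
theorem isParallel_sub_of_isIsolatedZero [FiniteDimensional ℂ E] [Nontrivial E] (hρ : 0 < ρ)
    (hX : DifferentiableOn ℂ X (ball p ρ)) (hT : RegularTrajectoriesInLines X (ball p ρ))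
    (hp : IsIsolatedZero X p) : ∀ z ∈ ball p ρ, IsParallel (X z) (z - p) := by
  have : CompleteSpace E := FiniteDimensional.complete ℂ E
  have hpar : ∀ m ∈ ball p ρ, ∀ s : ℂ, m + s • X m ∈ ball p ρ →
      IsParallel (X (m + s • X m)) (X m) := fun m hm s hs =>
    isParallel_of_regularTrajectoriesInLines hX hT hm hs
  obtain ⟨v, hv, hinv⟩ := exists_invariant_direction hρ hX hpar hp.2
  obtain ⟨ε, hε, hball⟩ := Metric.eventually_nhds_iff_ball.1 (eventually_nhdsWithin_iff.1 hp.2)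
  obtain ⟨R, hR0, hRε, hRρ⟩ : ∃ R > 0, 3 * R ≤ ε ∧ 3 * R < ρ := by
    refine ⟨min ε ρ / 4, by positivity, ?_, ?_⟩
    · have := min_le_left ε ρ; linarith
    · have := min_le_right ε ρ
      have : 0 < min ε ρ := by positivity
      linarith
  have hnv : ‖(R : ℂ) • v‖ = R := by simp [norm_smul, hv, abs_of_pos hR0]
  have hmem : p + (R : ℂ) • v ∈ ball p ρ := by
    rw [mem_ball, dist_eq_norm, add_sub_cancel_left, hnv]; linarith
  have hev := eventually_isParallel_sub hX hpar hp.1 hRρ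
    (fun z hz hne => hball z (ball_subset_ball hRε hz) hne) hnv hR0
    ((hinv R hmem).trans (isParallel_smul_self (R : ℂ) v).symm (by rintro rfl; simp at hv))
  intro z hz ℓ
  have hXℓ : DifferentiableOn ℂ (fun z => ℓ (X z)) (ball p ρ) :=
    ℓ.differentiable.comp_differentiableOn hX
  have := eqOn_zero_of_eventuallyEq_zero_of_convex
    (G := fun z => ℓ (z - p) • X z - ℓ (X z) • (z - p)) isOpen_ball (convex_ball p ρ)
    (by fun_prop) hmem
    (hev.mono fun z hz => sub_eq_zero.2 (hz ℓ)) z hz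
  exact sub_eq_zero.1 this

end Field

/-! ### Isolated singularities and zeros in dimension at least two -/

section Hartogs

variable {E : Type*} [NormedAddCommGroup E] [NormedSpace ℂ E]

/-- A holomorphic function on a punctured neighbourhood extends across the puncture along
circles: the mean value over a circle around the puncture is differentiable there. -/
theorem differentiableAt_circleAverage_smul [FiniteDimensional ℂ E] {u : E → ℂ} {ρ R : ℝ} {e : E}
    (hu : DifferentiableOn ℂ u (ball 0 ρ \ {0})) (hR : 0 < R) (he : ‖e‖ = 1) (hRρ : R < ρ) :
    DifferentiableAt ℂ (fun z => Real.circleAverage (fun w => u (z + w • e)) 0 R) 0 := by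
  have hopen : IsOpen (ball (0 : E) ρ \ {0}) := isOpen_ball.sdiff isClosed_singleton
  have hmem : ∀ w ∈ sphere (0 : ℂ) R, w • e ∈ ball (0 : E) ρ \ {0} := fun w hw => by
    have hw' : ‖w‖ = R := by simpa using hw
    have : ‖w • e‖ = R := by rw [norm_smul, he, hw', mul_one]
    refine ⟨by simpa [this] using hRρ, ?_⟩
    rw [mem_singleton_iff, ← norm_eq_zero, this]
    exact hR.ne'
  have hua : ∀ w ∈ sphere (0 : ℂ) R, ContinuousAt u (w • e) := fun w hw =>
    (hu.differentiableAt (hopen.mem_nhds (hmem w hw))).continuousAt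
  obtain ⟨M, hM⟩ : ∃ M : ℝ, ∀ w ∈ sphere (0 : ℂ) R, ‖u (w • e)‖ < M := by
    have hc : ContinuousOn (fun w : ℂ => ‖u (w • e)‖) (sphere 0 R) := fun w hw =>
      (ContinuousAt.norm (ContinuousAt.comp (f := fun w : ℂ => w • e) (hua w hw)
        (by fun_prop))).continuousWithinAt
    obtain ⟨M, hM⟩ := (isCompact_sphere (0 : ℂ) R).bddAbove_image hc
    exact ⟨M + 1, fun w hw => (hM (mem_image_of_mem _ hw)).trans_lt (lt_add_one M)⟩
  have hev : ∀ᶠ z in 𝓝 (0 : E), ∀ w ∈ sphere (0 : ℂ) R,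
      z + w • e ∈ ball (0 : E) ρ \ {0} ∧ ‖u (z + w • e)‖ < M := by
    refine (isCompact_sphere (0 : ℂ) R).eventually_forall_of_forall_eventually fun w hw => ?_
    have hc : ContinuousAt (fun q : E × ℂ => q.1 + q.2 • e) (0, w) := by fun_prop
    refine (hc.eventually (hopen.mem_nhds ?_)).and ?_
    · simpa using hmem w hw
    · have h1 : ContinuousAt (fun q : E × ℂ => ‖u (q.1 + q.2 • e)‖) (0, w) :=
        (ContinuousAt.comp (g := u) (f := fun q : E × ℂ => q.1 + q.2 • e)
          (by simpa using hua w hw) hc).norm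
      exact h1.eventually (gt_mem_nhds (by simpa using hM w hw))
  obtain ⟨ε, hε, hball⟩ := Metric.eventually_nhds_iff_ball.1 hev
  have hcm : ∀ θ, circleMap 0 R θ ∈ sphere (0 : ℂ) R := fun θ => circleMap_mem_sphere 0 hR.le θ
  -- Near the circle `u` is bounded by `M` on balls of radius `ε`, so Schwarz gives the Lipschitz
  -- constant `2 * M / ε`.
  have hint := hasFDerivAt_integral_of_dominated_loc_of_lip' (𝕜 := ℂ)
    (μ := MeasureTheory.volume.restrict (Ioc 0 (2 * Real.pi)))
    (F := fun (z : E) (θ : ℝ) => u (z + circleMap 0 R θ • e)) (x₀ := 0)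
    (F' := fun θ => fderiv ℂ u (circleMap 0 R θ • e)) (bound := fun _ => 2 * M / ε)
    (s := ball 0 ε) (ball_mem_nhds _ hε) ?_ ?_ ?_ ?_ ?_ ?_
  · simp only [Real.circleAverage, intervalIntegral.integral_of_le Real.two_pi_pos.le]
    exact hint.2.differentiableAt.const_smul _
  · intro z hz
    refine Continuous.aestronglyMeasurable (continuous_iff_continuousAt.2 fun θ => ?_)
    refine ContinuousAt.comp (g := u) (f := fun θ => z + circleMap 0 R θ • e)
      (hu.differentiableAt (hopen.mem_nhds (hball z hz _ (hcm θ)).1)).continuousAt ?_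
    exact (continuous_const.add ((continuous_circleMap 0 R).smul continuous_const)).continuousAt
  · refine Continuous.integrableOn_Ioc (continuous_iff_continuousAt.2 fun θ => ?_)
    simp only [zero_add]
    exact ContinuousAt.comp (g := u) (f := fun θ => circleMap 0 R θ • e) (hua _ (hcm θ))
      ((continuous_circleMap 0 R).smul continuous_const).continuousAt
  · borelize E
    have hm : Measurable fun θ => circleMap 0 R θ • e :=
      ((continuous_circleMap 0 R).smul continuous_const).measurable
    have : SecondCountableTopology (E →L[ℂ] ℂ) := by
      have := FiniteDimensional.proper ℂ (E →L[ℂ] ℂ)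
      infer_instance
    exact ((measurable_fderiv ℂ u).comp hm).aestronglyMeasurable
  · refine .of_forall fun θ z hz => ?_
    set c := circleMap 0 R θ • e with hc
    have hsub : ∀ y ∈ ball c ε, y ∈ ball (0 : E) ρ \ {0} ∧ ‖u y‖ < M := fun y hy => by
      have := hball (y - c) (by simpa [dist_eq_norm] using hy) _ (hcm θ)
      rwa [← hc, sub_add_cancel] at this
    have h := Complex.dist_le_div_mul_dist_of_mapsTo_ball (f := u) (c := c) (z := z + c) (R₁ := ε)
      (R₂ := 2 * M) (hu.mono fun y hy => (hsub y hy).1) (fun y hy => by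
        rw [mem_closedBall, dist_eq_norm]
        have h1 := (hsub y hy).2
        have h2 := (hsub c (mem_ball_self hε)).2
        have := norm_sub_le (u y) (u c)
        linarith) (by simpa [dist_eq_norm] using hz)
    simpa [dist_eq_norm] using h
  · simp
  · refine .of_forall fun θ => ?_
    have h1 := (hu.differentiableAt (hopen.mem_nhds (hmem _ (hcm θ)))).hasFDerivAt
    have h2 : HasFDerivAt (fun z : E => z + circleMap 0 R θ • e) (ContinuousLinearMap.id ℂ E) 0 :=
      (hasFDerivAt_id 0).add_const _
    have := HasFDerivAt.comp (g := u) (0 : E) (by simpa using h1) h2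
    rwa [ContinuousLinearMap.comp_id] at this

/-- A small disc in the direction `e` whose centre is not on the line through `0` in that direction
stays in the punctured ball. -/
theorem add_smul_mem_punctured_ball {ρ R : ℝ} {e z : E} (he : ‖e‖ = 1) (hRρ : 2 * R < ρ)
    (hz : z ∈ ball (0 : E) R) (hze : z ∉ Submodule.span ℂ {e}) {w : ℂ}
    (hw : w ∈ closedBall (0 : ℂ) R) : z + w • e ∈ ball (0 : E) ρ \ {0} := by
  have h1 := mem_ball_zero_iff.1 hz
  have h2 := mem_closedBall_zero_iff.1 hw
  refine ⟨?_, fun h => hze ?_⟩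
  · rw [mem_ball_zero_iff]
    refine (norm_add_le _ _).trans_lt ?_
    rw [norm_smul, he]
    linarith
  · rw [eq_neg_of_add_eq_zero_left (mem_singleton_iff.1 h), ← neg_smul]
    exact Submodule.smul_mem _ _ (Submodule.mem_span_singleton_self e)

theorem diffContOnCl_add_smul {u : E → ℂ} {ρ R : ℝ} {e z : E}
    (hu : DifferentiableOn ℂ u (ball 0 ρ \ {0})) (he : ‖e‖ = 1) (hR : 0 < R) (hRρ : 2 * R < ρ)
    (hz : z ∈ ball (0 : E) R) (hze : z ∉ Submodule.span ℂ {e}) :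
    DiffContOnCl ℂ (fun w : ℂ => u (z + w • e)) (ball 0 R) := by
  apply DifferentiableOn.diffContOnCl
  rw [closure_ball _ hR.ne']
  exact hu.comp (f := fun w : ℂ => z + w • e) (by fun_prop)
    fun w hw => add_smul_mem_punctured_ball he hRρ hz hze hw

/-- In dimension at least two, isolated singularities of holomorphic functions are removable. -/
theorem exists_differentiableOn_ball_of_punctured [FiniteDimensional ℂ E] {u : E → ℂ} {ρ : ℝ}
    {e f : E} (hρ : 0 < ρ) (hu : DifferentiableOn ℂ u (ball 0 ρ \ {0})) (he : ‖e‖ = 1)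
    (hf : f ∉ Submodule.span ℂ {e}) :
    ∃ U : E → ℂ, DifferentiableOn ℂ U (ball 0 ρ) ∧ ∀ z ≠ 0, U z = u z := by
  classical
  obtain ⟨R, hR, hRρ⟩ : ∃ R > 0, 2 * R < ρ := ⟨ρ / 3, by positivity, by linarith⟩
  have hopen : IsOpen (ball (0 : E) ρ \ {0}) := isOpen_ball.sdiff isClosed_singleton
  let A : E → ℂ := fun z => Real.circleAverage (fun w => u (z + w • e)) 0 R
  have hA0 : DifferentiableAt ℂ A 0 :=
    differentiableAt_circleAverage_smul hu hR he (by linarith)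
  -- Off the line spanned by `e` the disc of integration avoids the puncture, and the mean value
  -- property holds.
  have hA1 : ∀ z ∈ ball (0 : E) R, z ∉ Submodule.span ℂ {e} → A z = u z := fun z hz hze => by
    have := DiffContOnCl.circleAverage (R := R)
      (by rw [abs_of_pos hR]; exact diffContOnCl_add_smul hu he hR hRρ hz hze)
    simpa using this
  refine ⟨fun z => if z = 0 then A 0 else u z, fun z hz => ?_, fun z hz => if_neg hz⟩
  by_cases hz0 : z = 0
  · subst hz0
    refine HasFDerivAt.differentiableAt (f' := fderiv ℂ A 0) ?_ |>.differentiableWithinAt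
    rw [hasFDerivAt_iff_isLittleO, Asymptotics.isLittleO_iff]
    intro c hc
    obtain ⟨δ, hδ, hball⟩ := Metric.eventually_nhds_iff_ball.1
      ((Asymptotics.isLittleO_iff.1 (hasFDerivAt_iff_isLittleO.1 hA0.hasFDerivAt)) hc)
    filter_upwards [ball_mem_nhds 0 hδ, ball_mem_nhds 0 hR, isOpen_ball.mem_nhds hz] with z h1 h2 h3
    by_cases hz0 : z = 0
    · simp [hz0]
    simp only [if_neg hz0, if_true]
    have hcont : ContinuousAt u z :=
      (hu.differentiableAt (hopen.mem_nhds ⟨h3, hz0⟩)).continuousAt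
    have hbound : ∀ y ∈ ball (0 : E) δ ∩ (ball (0 : E) R ∩ {z | z ∉ Submodule.span ℂ {e}}),
        ‖u y - A 0 - fderiv ℂ A 0 (y - 0)‖ ≤ c * ‖y - 0‖ := fun y hy => by
      rw [← hA1 y hy.2.1 hy.2.2]
      exact hball y hy.1
    -- On the exceptional line the estimate is the limit of the estimates at `z + t • f`, off the
    -- line.
    by_cases hze : z ∈ Submodule.span ℂ {e}
    · have hl : Tendsto (fun t : ℂ => z + t • f) (𝓝[≠] 0) (𝓝 z) := by
        have : ContinuousAt (fun t : ℂ => z + t • f) 0 := by fun_prop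
        have := this.tendsto
        rw [zero_smul, add_zero] at this
        exact this.mono_left nhdsWithin_le_nhds
      have hcl : ContinuousAt (fun y => ‖u y - A 0 - fderiv ℂ A 0 (y - 0)‖) z := by fun_prop
      have hcr : ContinuousAt (fun y : E => c * ‖y - 0‖) z := by fun_prop
      refine le_of_tendsto_of_tendsto (hcl.tendsto.comp hl) (hcr.tendsto.comp hl) ?_
      filter_upwards [hl (isOpen_ball.mem_nhds h1), hl (isOpen_ball.mem_nhds h2),
        self_mem_nhdsWithin] with t ht1 ht2 ht0
      refine hbound _ ⟨ht1, ht2, fun hmem => hf ?_⟩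
      have := (Submodule.add_mem_iff_right _ hze).1 hmem
      exact (Submodule.smul_mem_iff _ ht0).1 this
    · exact hbound z ⟨h1, h2, hze⟩
  · refine DifferentiableAt.differentiableWithinAt ?_
    refine (hu.differentiableAt (hopen.mem_nhds ⟨hz, hz0⟩)).congr_of_eventuallyEq ?_
    filter_upwards [isOpen_ne.mem_nhds hz0] with y hy using if_neg hy

/-- In dimension at least two, zeros of holomorphic functions are not isolated. -/
theorem apply_zero_ne_zero_of_punctured {u : E → ℂ} {ρ : ℝ} {e f : E} (hρ : 0 < ρ)
    (hu : DifferentiableOn ℂ u (ball 0 ρ)) (he : ‖e‖ = 1) (hf : f ∉ Submodule.span ℂ {e})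
    (h0 : ∀ z ∈ ball (0 : E) ρ \ {0}, u z ≠ 0) : u 0 ≠ 0 := by
  obtain ⟨R, hR, hRρ⟩ : ∃ R > 0, 2 * R < ρ := ⟨ρ / 3, by positivity, by linarith⟩
  have huc : ∀ z ∈ ball (0 : E) ρ, ContinuousAt u z := fun z hz =>
    (hu.differentiableAt (isOpen_ball.mem_nhds hz)).continuousAt
  have hmem : ∀ w ∈ sphere (0 : ℂ) R, w • e ∈ ball (0 : E) ρ \ {0} := fun w hw => by
    have hw' : ‖w‖ = R := by simpa using hw
    have : ‖w • e‖ = R := by rw [norm_smul, he, hw', mul_one]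
    refine ⟨by rw [mem_ball_zero_iff, this]; linarith, ?_⟩
    rw [mem_singleton_iff, ← norm_eq_zero, this]
    exact hR.ne'
  obtain ⟨δ, hδ, hδs⟩ : ∃ δ > 0, ∀ w ∈ sphere (0 : ℂ) R, δ < ‖u (w • e)‖ := by
    have hne : ∀ w ∈ sphere (0 : ℂ) R, 0 < ‖u (w • e)‖ := fun w hw =>
      norm_pos_iff.2 (h0 _ (hmem w hw))
    have hc : ContinuousOn (fun w : ℂ => ‖u (w • e)‖) (sphere 0 R) := fun w hw =>
      (ContinuousAt.norm (ContinuousAt.comp (f := fun w : ℂ => w • e) (huc _ (hmem w hw).1)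
        (by fun_prop))).continuousWithinAt
    obtain ⟨w, hw, hmin⟩ := (isCompact_sphere (0 : ℂ) R).exists_isMinOn
      (NormedSpace.sphere_nonempty.2 hR.le) hc
    exact ⟨‖u (w • e)‖ / 2, half_pos (hne w hw), fun y hy =>
      (half_lt_self (hne w hw)).trans_le (hmin hy)⟩
  have hev : ∀ᶠ z in 𝓝 (0 : E), ∀ w ∈ sphere (0 : ℂ) R, δ < ‖u (z + w • e)‖ := by
    refine (isCompact_sphere (0 : ℂ) R).eventually_forall_of_forall_eventually fun w hw => ?_
    have h1 : ContinuousAt (fun q : E × ℂ => ‖u (q.1 + q.2 • e)‖) (0, w) :=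
      (ContinuousAt.comp (g := u) (f := fun q : E × ℂ => q.1 + q.2 • e)
        (by simpa using huc _ (hmem w hw).1) (by fun_prop)).norm
    exact h1.eventually (lt_mem_nhds (by simpa using hδs w hw))
  have hl : Tendsto (fun t : ℂ => t • f) (𝓝[≠] 0) (𝓝 0) := by
    have : ContinuousAt (fun t : ℂ => t • f) 0 := by fun_prop
    have := this.tendsto
    rw [zero_smul] at this
    exact this.mono_left nhdsWithin_le_nhds
  have hle : δ ≤ ‖u 0‖ := by
    -- At the points `t • f` the disc in direction `e` avoids `0`, so `u` has no zeros on it and the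
    -- minimum modulus principle applies.
    refine ge_of_tendsto (((huc 0 (mem_ball_self hρ)).norm.tendsto).comp hl) ?_
    filter_upwards [hl hev, hl (ball_mem_nhds 0 hR), self_mem_nhdsWithin] with t h1 h2 h3
    have hte : t • f ∉ Submodule.span ℂ {e} := fun h => hf ((Submodule.smul_mem_iff _ h3).1 h)
    have := le_norm_of_forall_sphere_le_norm hR hδ
      (diffContOnCl_add_smul (hu.mono sdiff_subset) he hR hRρ h2 hte)
      (fun w hw => h0 _ (add_smul_mem_punctured_ball he hRρ h2 hte hw)) (fun w hw => (h1 w hw).le)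
    simpa using this
  exact norm_pos_iff.1 (hδ.trans_le hle)

/-- A holomorphic vector field that is parallel to the position vector, with an isolated zero at
the origin, is the product of a function with the radial field. -/
theorem exists_eq_smul_of_isParallel [FiniteDimensional ℂ E] {X : E → E} {ρ : ℝ} {e f : E}
    (hρ : 0 < ρ) (he : ‖e‖ = 1) (hf : f ∉ Submodule.span ℂ {e})
    (hX : DifferentiableOn ℂ X (ball 0 ρ)) (h0 : IsIsolatedZero X 0)
    (hpar : ∀ z ∈ ball (0 : E) ρ, IsParallel (X z) z) :
    ∃ u : E → ℂ, DifferentiableOn ℂ u (ball 0 ρ) ∧ (∀ z ∈ ball (0 : E) ρ, X z = u z • z) ∧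
      ∀ z ∈ ball (0 : E) ρ, z = 0 ∨ X z ≠ 0 → u z ≠ 0 := by
  have hex : ∀ z : E, ∃ c : ℂ, z ∈ ball (0 : E) ρ → z ≠ 0 → X z = c • z := fun z => by
    by_cases hz : z ∈ ball (0 : E) ρ ∧ z ≠ 0
    · obtain ⟨ℓ, hℓ⟩ := exists_clm_apply_eq_one hz.2
      exact ⟨_, fun _ _ => (hpar z hz.1).eq_smul (ℓ := ℓ) (by simp [hℓ])⟩
    · exact ⟨0, fun h1 h2 => absurd ⟨h1, h2⟩ hz⟩
  choose u₀ hu₀ using hex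
  have hu₀d : DifferentiableOn ℂ u₀ (ball 0 ρ \ {0}) := by
    rintro z ⟨hz, hz0⟩
    obtain ⟨ℓ, hℓ⟩ := exists_clm_apply_eq_one (show z ≠ 0 from hz0)
    have hne : ℓ z ≠ 0 := by simp [hℓ]
    -- The chosen factor is forced off `0`: near `z` it is this quotient.
    have hd : DifferentiableAt ℂ (fun y => ℓ (X y) / ℓ y) z := by
      simp only [div_eq_mul_inv]
      refine DifferentiableAt.mul ?_ ((differentiableAt_inv hne).comp z ℓ.differentiableAt)
      exact ℓ.differentiableAt.comp z (hX.differentiableAt (isOpen_ball.mem_nhds hz))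
    refine (hd.congr_of_eventuallyEq ?_).differentiableWithinAt
    filter_upwards [isOpen_ball.mem_nhds hz, ℓ.continuous.continuousAt.eventually_ne hne,
      isOpen_ne.mem_nhds hz0] with y h1 h2 h3
    have := congrArg ℓ (hu₀ y h1 h3)
    rw [map_smul, smul_eq_mul] at this
    rw [this, mul_div_cancel_right₀ _ h2]
  obtain ⟨u, hu, huu⟩ := exists_differentiableOn_ball_of_punctured hρ hu₀d he hf
  have hXu : ∀ z ∈ ball (0 : E) ρ, X z = u z • z := fun z hz => by
    by_cases hz0 : z = 0
    · rw [hz0, h0.1, smul_zero]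
    · rw [huu z hz0, hu₀ z hz hz0]
  refine ⟨u, hu, hXu, ?_⟩
  have hu0 : ∀ z ∈ ball (0 : E) ρ, X z ≠ 0 → u z ≠ 0 := fun z hz hne h => by
    apply hne; rw [hXu z hz, h, zero_smul]
  rintro z hz (rfl | hne)
  · obtain ⟨ε, hε, hball⟩ := Metric.eventually_nhds_iff_ball.1 (eventually_nhdsWithin_iff.1 h0.2)
    have hsub : ball (0 : E) (min ε ρ) ⊆ ball 0 ρ := ball_subset_ball (min_le_right _ _)
    refine apply_zero_ne_zero_of_punctured (lt_min hε hρ) (hu.mono hsub) he hf fun z hz => ?_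
    exact hu0 z (hsub hz.1) (hball z (ball_subset_ball (min_le_left _ _) hz.1) hz.2)
  · exact hu0 z hz hne

end Hartogs

/-- A vector field on a ball whose trajectories lie in lines is radial at an isolated zero. -/
theorem exists_eq_smul_of_trajectoriesInLines {n : ℕ} (hn : 2 ≤ n) {ρ : ℝ} (hρ : 0 < ρ)
    {X : EuclideanSpace ℂ (Fin n) → EuclideanSpace ℂ (Fin n)}
    (hX : DifferentiableOn ℂ X (ball 0 ρ)) (h0 : IsIsolatedZero X 0)
    (hT : TrajectoriesInLines X (ball 0 ρ)) :
    ∃ u : EuclideanSpace ℂ (Fin n) → ℂ, DifferentiableOn ℂ u (ball 0 ρ) ∧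
      (∀ z ∈ ball (0 : EuclideanSpace ℂ (Fin n)) ρ, X z = u z • z) ∧
      ∀ z ∈ ball (0 : EuclideanSpace ℂ (Fin n)) ρ, z = 0 ∨ X z ≠ 0 → u z ≠ 0 := by
  have hne : (⟨0, by omega⟩ : Fin n) ≠ ⟨1, by omega⟩ := by simp
  have : Nonempty (Fin n) := ⟨⟨0, by omega⟩⟩
  have he : ‖EuclideanSpace.single (⟨0, by omega⟩ : Fin n) (1 : ℂ)‖ = 1 := by simp
  refine exists_eq_smul_of_isParallel hρ he
    (f := EuclideanSpace.single (⟨1, by omega⟩ : Fin n) (1 : ℂ)) ?_ hX h0 ?_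
  · rw [Submodule.mem_span_singleton]
    rintro ⟨a, ha⟩
    have := congrArg (fun x : EuclideanSpace ℂ (Fin n) => x ⟨1, by omega⟩) ha
    simp at this
  · intro z hz
    have := isParallel_sub_of_isIsolatedZero hρ hX (fun T φ h _ _ _ => hT T φ h) h0 z hz
    rwa [sub_zero] at this

/-! ### Polynomial fields on affine space -/

section Polynomial

open MvPolynomial

/-- `P i` divides every `P j * R i`, hence their gcd, which is `R i` up to a unit because the `P j`
are coprime. -/
theorem dvd_of_mul_eq_mul_of_noCommonFactor {n : ℕ} {P R : Fin n → MvPolynomial (Fin n) ℂ}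
    (h : ∀ i j, P i * R j = P j * R i) (hP : NoCommonFactor P) (i : Fin n) : P i ∣ R i := by
  let : NormalizedGCDMonoid (MvPolynomial (Fin n) ℂ) := Classical.arbitrary _
  have hu : IsUnit (Finset.univ.gcd P) := hP _ fun j => Finset.gcd_dvd (Finset.mem_univ j)
  have h1 : P i ∣ Finset.univ.gcd fun j => P j * R i :=
    Finset.dvd_gcd fun j _ => ⟨R j, (h i j).symm⟩
  have h2 := h1.trans (Finset.gcd_mul_right' (s := Finset.univ) (f := P) (R i)).dvd
  exact (hu.dvd_mul_left).1 h2

/-- Two proportional polynomial vector fields without common factors differ by a constant. -/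
theorem exists_eq_C_mul_of_noCommonFactor {n : ℕ}
    {P R : Fin n → MvPolynomial (Fin n) ℂ} (h : ∀ i j, P i * R j = P j * R i)
    (hP : NoCommonFactor P) (hR : NoCommonFactor R) : ∃ c : ℂ, c ≠ 0 ∧ ∀ i, P i = C c * R i := by
  obtain ⟨i, hi⟩ : ∃ i, R i ≠ 0 := by
    by_contra! hcon
    exact not_isUnit_zero (hR 0 fun i => by rw [hcon i])
  have hass : Associated (R i) (P i) := associated_of_dvd_dvd
    (dvd_of_mul_eq_mul_of_noCommonFactor (fun a b => by rw [mul_comm, h b a, mul_comm]) hR i)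
    (dvd_of_mul_eq_mul_of_noCommonFactor h hP i)
  obtain ⟨u, hu⟩ := hass
  obtain ⟨c, hc, huc⟩ := isUnit_iff_eq_C_of_isReduced.1 u.isUnit
  refine ⟨c, hc.ne_zero, fun j => mul_right_cancel₀ hi ?_⟩
  rw [← h i j, ← hu, huc]
  ring

/-- The field `a - b z` is free of common factors in dimension at least two. -/
theorem noCommonFactor_C_sub_C_mul_X {n : ℕ} (hn : 2 ≤ n) {a : Fin n → ℂ} {b : ℂ}
    (h : b ≠ 0 ∨ ∃ i, a i ≠ 0) : NoCommonFactor fun i => C (a i) - C b * X i := by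
  intro g hg
  beta_reduce at hg
  -- For `b = 0` the field is constant: its lines are parallel and meet at infinity.
  by_cases hb : b = 0
  · obtain ⟨i, hi⟩ := h.resolve_left (not_not.2 hb)
    have := hg i
    simp only [hb, map_zero, zero_mul, sub_zero] at this
    exact isUnit_of_dvd_unit this (hi.isUnit.map C)
  · have hirr : ∀ i, Irreducible (C (a i) - C b * X i : MvPolynomial (Fin n) ℂ) := fun i => by
      have hcoeff : coeff (Finsupp.single i 1) (C (a i) - C b * X i : MvPolynomial (Fin n) ℂ) =
          -b := by
        rw [coeff_sub, coeff_C_mul, coeff_X, coeff_C, if_neg]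
        · simp
        · intro h0
          have := DFunLike.congr_fun h0 i
          simp at this
      refine irreducible_of_totalDegree_eq_one (le_antisymm ?_ ?_) ?_
      · refine (totalDegree_sub _ _).trans (max_le (by simp) ?_)
        refine (totalDegree_mul _ _).trans ?_
        simp
      · have := le_totalDegree (p := (C (a i) - C b * X i : MvPolynomial (Fin n) ℂ))
          (s := Finsupp.single i 1) (by rw [mem_support_iff, hcoeff]; simpa using hb)
        simpa using this
      · intro x hx
        have := hx (Finsupp.single i 1)
        rw [hcoeff] at this
        exact isUnit_of_dvd_unit this (neg_ne_zero.2 hb).isUnit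
    let i : Fin n := ⟨0, by omega⟩
    let j : Fin n := ⟨1, by omega⟩
    have hij : j ≠ i := by simp [i, j]
    by_contra hg'
    obtain ⟨q, hq⟩ := hg i
    obtain ⟨u, hu⟩ := ((hirr i).isUnit_or_isUnit hq).resolve_left hg'
    have hdvd : (C (a i) - C b * X i : MvPolynomial (Fin n) ℂ) ∣ C (a j) - C b * X j := by
      refine dvd_trans ?_ (hg j)
      rw [hq, ← hu]
      exact (Units.mul_right_dvd).2 dvd_rfl
    -- At this point the `i`-th component vanishes and the `j`-th equals `-1`.
    have := map_dvd (eval fun k => if k = i then a i / b else (a j + 1) / b) hdvd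
    simp [hij, mul_div_cancel₀ _ hb] at this

theorem differentiable_polyField {n : ℕ} (P : Fin n → MvPolynomial (Fin n) ℂ) :
    Differentiable ℂ (polyField P) := by
  rw [differentiable_pi]
  intro i z
  exact (AnalyticOnNhd.eval_mvPolynomial (P i) z (mem_univ z)).differentiableAt

/-- A polynomial foliation by lines is radial at an isolated zero. -/
theorem exists_eq_C_mul_X_sub_C_of_isAffineFoliationByLines {n : ℕ} (hn : 2 ≤ n)
    {P : Fin n → MvPolynomial (Fin n) ℂ} {p : Fin n → ℂ} (hP : IsAffineFoliationByLines P)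
    (hp : IsIsolatedZero (polyField P) p) :
    ∃ c : ℂ, c ≠ 0 ∧ ∀ i, P i = C c * (X i - C (p i)) := by
  have hlines : RegularTrajectoriesInLines (polyField P) (ball p 1) := by
    rintro T φ ⟨hT, hTc, hφ⟩ t₀ ht₀ hne
    obtain ⟨D, hD, hleaf⟩ := hP.2 (φ t₀) hne
    exact ⟨D, hD, fun t ht => hleaf _ (Relation.ReflTransGen.single
      ⟨T, φ, ⟨hT, hTc, fun s hs => ⟨mem_univ _, (hφ s hs).2⟩⟩, mem_image_of_mem _ ht₀,
        mem_image_of_mem _ ht⟩)⟩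
  have : Nonempty (Fin n) := ⟨⟨0, by omega⟩⟩
  have hpar := isParallel_sub_of_isIsolatedZero one_pos (differentiable_polyField P).differentiableOn
    hlines hp
  refine exists_eq_C_mul_of_noCommonFactor (fun i j => ?_) hP.1 ?_
  · refine funext_set (fun k => ball (p k) 1)
      (fun k => infinite_of_mem_nhds (p k) (ball_mem_nhds _ one_pos)) fun z hz => ?_
    rw [← ball_pi _ one_pos] at hz
    have := congrFun (hpar z hz (ContinuousLinearMap.proj j)) i
    simp only [ContinuousLinearMap.proj_apply, Pi.smul_apply, Pi.sub_apply, smul_eq_mul,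
      polyField] at this
    simp only [map_mul, map_sub, eval_X, eval_C]
    rw [← this, mul_comm]
  · have h1 : NoCommonFactor fun i => C (-p i) - C (-1 : ℂ) * X i :=
      noCommonFactor_C_sub_C_mul_X hn (.inl (by norm_num))
    convert h1 using 2
    simp
    ring

end Polynomial

/-! ### Charts and foliations of projective space -/

section Projective

variable {n : ℕ}

@[simp] theorem chartVec_apply_same (j : Fin (n + 1)) (z : Fin n → ℂ) : chartVec j z j = 1 := by
  simp [chartVec]

@[simp] theorem chartVec_apply_succAbove (j : Fin (n + 1)) (z : Fin n → ℂ) (i : Fin n) :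
    chartVec j z (j.succAbove i) = z i := by
  simp [chartVec]

@[simp] theorem chartDir_apply_same (j : Fin (n + 1)) (v : Fin n → ℂ) : chartDir j v j = 0 := by
  simp [chartDir]

@[simp] theorem chartDir_apply_succAbove (j : Fin (n + 1)) (v : Fin n → ℂ) (i : Fin n) :
    chartDir j v (j.succAbove i) = v i := by
  simp [chartDir]

theorem chart_ext (j : Fin (n + 1)) {x y : Fin (n + 1) → ℂ} (h : x j = y j)
    (h' : ∀ i, x (j.succAbove i) = y (j.succAbove i)) : x = y :=
  funext fun k => Fin.succAboveCases j h h' k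

/-- `chartDir` as a linear map. -/
noncomputable def chartDirLinear (j : Fin (n + 1)) : (Fin n → ℂ) →ₗ[ℂ] (Fin (n + 1) → ℂ) where
  toFun := chartDir j
  map_add' v w := chart_ext j (by simp) (by simp)
  map_smul' c v := chart_ext j (by simp) (by simp)

@[simp] theorem chartDirLinear_apply (j : Fin (n + 1)) (v : Fin n → ℂ) :
    chartDirLinear j v = chartDir j v := rfl

theorem chartDirLinear_injective (j : Fin (n + 1)) :
    Function.Injective (chartDirLinear (n := n) j) := fun v w h => by
  ext i
  simpa using congrFun h (j.succAbove i)

theorem chartDir_smul (j : Fin (n + 1)) (c : ℂ) (v : Fin n → ℂ) :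
    chartDir j (c • v) = c • chartDir j v := (chartDirLinear j).map_smul c v

theorem chartDir_sub (j : Fin (n + 1)) (z w : Fin n → ℂ) :
    chartDir j (z - w) = chartVec j z - chartVec j w :=
  chart_ext j (by simp) (by simp)

/-- In a chart, the vector field whose trajectories lie on the lines through the point with
homogeneous coordinates `x`. -/
def pencilField (k : Fin (n + 1)) (x : Fin (n + 1) → ℂ) (w : Fin n → ℂ) : Fin n → ℂ :=
  fun i => x (k.succAbove i) - x k * w i

/-- The tangent direction towards `x` is `x` modulo the vector of the point, corrected so that its
`k`-th coordinate is `0`. -/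
theorem chartDir_pencilField (k : Fin (n + 1)) (x : Fin (n + 1) → ℂ) (w : Fin n → ℂ) :
    chartDir k (pencilField k x w) = x - x k • chartVec k w :=
  chart_ext k (by simp) (by simp [pencilField])

theorem chartPt_submodule (j : Fin (n + 1)) (z : Fin n → ℂ) :
    (chartPt j z).submodule = Submodule.span ℂ {chartVec j z} :=
  Projectivization.submodule_mk _ _

theorem chartPt_eq_iff (j k : Fin (n + 1)) (z w : Fin n → ℂ) :
    chartPt j z = chartPt k w ↔ ∃ a : ℂ, a • chartVec k w = chartVec j z :=
  Projectivization.mk_eq_mk_iff' _ _ _ _ _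

/-- The affine trace of a projective line is a line. -/
theorem finrank_comap_chartDirLinear (j : Fin (n + 1)) {z : Fin n → ℂ}
    {W : Submodule ℂ (Fin (n + 1) → ℂ)} (hW : Module.finrank ℂ W = 2) (hz : chartVec j z ∈ W) :
    Module.finrank ℂ (W.comap (chartDirLinear j)) = 1 := by
  set V := W.comap (chartDirLinear j)
  have hV : Module.finrank ℂ (V.map (chartDirLinear j)) = Module.finrank ℂ V :=
    (Submodule.equivMapOfInjective _ (chartDirLinear_injective j) V).finrank_eq.symm
  have hsup : V.map (chartDirLinear j) ⊔ Submodule.span ℂ {chartVec j z} = W := by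
    apply le_antisymm
    · refine sup_le (Submodule.map_comap_le _ _) ?_
      rwa [Submodule.span_singleton_le_iff_mem]
    · intro x hx
      have hd := chartDir_pencilField j x z
      have hmem : pencilField j x z ∈ V := by
        rw [Submodule.mem_comap, chartDirLinear_apply, hd]
        exact W.sub_mem hx (W.smul_mem _ hz)
      rw [← sub_add_cancel x (x j • chartVec j z), ← hd]
      exact Submodule.add_mem_sup (Submodule.mem_map_of_mem hmem)
        (Submodule.smul_mem _ _ (Submodule.mem_span_singleton_self _))
  have hinf : V.map (chartDirLinear j) ⊓ Submodule.span ℂ {chartVec j z} = ⊥ := by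
    rw [eq_bot_iff]
    rintro x ⟨⟨v, -, rfl⟩, hx⟩
    obtain ⟨a, ha⟩ := Submodule.mem_span_singleton.1 hx
    have : a = 0 := by simpa using congrFun ha j
    rw [Submodule.mem_bot, ← ha, this, zero_smul]
  have := Submodule.finrank_sup_add_finrank_inf_eq (V.map (chartDirLinear j))
    (Submodule.span ℂ {chartVec j z})
  rw [hsup, hinf, hV, hW, finrank_bot, finrank_span_singleton (chartVec_ne_zero j z)] at this
  omega

namespace ProjFoliation

/-- Singularity does not depend on the chart: a zero in another chart would shrink the common
tangent span to the line over the point. -/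
theorem chartPt_notMem_sing (F : ProjFoliation n) {j : Fin (n + 1)} {z : Fin n → ℂ}
    (hz : polyField (F.field j) z ≠ 0) : chartPt j z ∉ F.sing := by
  rintro ⟨k, w, hkw, hw⟩
  have h := F.compatible j k z w hkw
  have hmem : chartDir j (polyField (F.field j) z) ∈ tangentSpan j (F.field j) z :=
    Submodule.subset_span (by simp)
  have h0 : chartDir k (0 : Fin n → ℂ) = 0 := (chartDirLinear k).map_zero
  rw [h, tangentSpan, hw, h0, Set.pair_comm, Submodule.span_insert_zero, ← chartPt_submodule,
    ← hkw, chartPt_submodule] at hmem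
  obtain ⟨a, ha⟩ := Submodule.mem_span_singleton.1 hmem
  have ha0 : a = 0 := by simpa using congrFun ha j
  apply hz
  apply chartDirLinear_injective j
  rw [map_zero, chartDirLinear_apply, ← ha, ha0, zero_smul]

/-- In every chart, a projective foliation by lines is an affine foliation by lines. -/
theorem ByLines.isAffineFoliationByLines {F : ProjFoliation n} (hF : F.ByLines)
    (j : Fin (n + 1)) : IsAffineFoliationByLines (F.field j) := by
  refine ⟨F.noCommonFactor j, fun m hm => ?_⟩
  obtain ⟨W, hW, hleaf⟩ := hF _ (F.chartPt_notMem_sing hm)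
  have hmem : ∀ m' ∈ affineLeaf (F.field j) m, chartVec j m' ∈ W := fun m' hm' => by
    have : chartPt j m' ∈ F.leaf (chartPt j m) := by
      refine Relation.ReflTransGen.lift (chartPt j) ?_ _ _ hm'
      rintro a b ⟨T, φ, hφ, ⟨s, hs, rfl⟩, ⟨t, ht, rfl⟩⟩
      exact ⟨j, T, φ, hφ, ⟨s, hs, rfl⟩, ⟨t, ht, rfl⟩⟩
    have := hleaf _ this
    rwa [chartPt_submodule, Submodule.span_singleton_le_iff_mem] at this
  have hmW : chartVec j m ∈ W := hmem m Relation.ReflTransGen.refl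
  refine ⟨AffineSubspace.mk' m (W.comap (chartDirLinear j)), ?_, fun m' hm' => ?_⟩
  · rw [IsComplexLine, AffineSubspace.direction_mk']
    exact finrank_comap_chartDirLinear j hW hmW
  · rw [AffineSubspace.mem_mk', vsub_eq_sub, Submodule.mem_comap, chartDirLinear_apply,
      chartDir_sub]
    exact W.sub_mem (hmem m' hm') hmW

/-- If a foliation is radial in one chart, it is generated by the same pencil in every chart, at
the points of the first chart. -/
theorem exists_polyField_eq_smul_pencilField (F : ProjFoliation n) {j : Fin (n + 1)}
    {p : Fin n → ℂ} {c : ℂ} (hF : ∀ z, polyField (F.field j) z = c • (z - p)) (k : Fin (n + 1))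
    {w : Fin n → ℂ} (hw : chartVec k w j ≠ 0) :
    ∃ b : ℂ, polyField (F.field k) w = b • pencilField k (chartVec j p) w := by
  set x := chartVec k w
  let z : Fin n → ℂ := fun i => (x j)⁻¹ * x (j.succAbove i)
  have hz : chartVec j z = (x j)⁻¹ • x := chart_ext j (by simp [hw]) (by simp [z])
  have hpt : chartPt k w = chartPt j z :=
    (chartPt_eq_iff _ _ _ _).2 ⟨x j, by rw [hz, smul_smul, mul_inv_cancel₀ hw, one_smul]⟩
  have hmem : chartDir k (polyField (F.field k) w) ∈ tangentSpan k (F.field k) w :=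
    Submodule.subset_span (by simp)
  rw [F.compatible k j w z hpt, tangentSpan, hF, chartDir_smul, chartDir_sub, hz,
    Submodule.mem_span_pair] at hmem
  obtain ⟨s, t, hst⟩ := hmem
  have hp := chartDir_pencilField k (chartVec j p) w
  have hcomb : chartDir k (polyField (F.field k) w) =
      (s * (x j)⁻¹ + t * c * (x j)⁻¹ - t * c * chartVec j p k) • x
        + (-(t * c)) • chartDir k (pencilField k (chartVec j p) w) := by
    rw [← hst, hp]
    module
  -- Compare `k`-th coordinates: directions have `0` there and `x` has `1`.
  have h0 : s * (x j)⁻¹ + t * c * (x j)⁻¹ - t * c * chartVec j p k = 0 := by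
    have := congrFun hcomb k
    simpa [x] using this.symm
  rw [h0, zero_smul, zero_add, ← chartDir_smul] at hcomb
  exact ⟨_, chartDirLinear_injective k hcomb⟩

/-- If a foliation is radial in one chart, it is generated by the same pencil in every chart. -/
theorem exists_polyField_eq_smul_pencilField_of_forall (F : ProjFoliation n) (hn : 2 ≤ n)
    {j : Fin (n + 1)} {p : Fin n → ℂ} {c : ℂ}
    (hF : ∀ z, polyField (F.field j) z = c • (z - p)) (k : Fin (n + 1)) :
    ∃ b : ℂ, b ≠ 0 ∧ ∀ w, polyField (F.field k) w = b • pencilField k (chartVec j p) w := by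
  set x := chartVec j p
  have hnc : NoCommonFactor fun i =>
      (MvPolynomial.C (x (k.succAbove i)) - MvPolynomial.C (x k) * MvPolynomial.X i :
        MvPolynomial (Fin n) ℂ) := by
    apply noCommonFactor_C_sub_C_mul_X hn
    by_contra! h
    exact chartVec_ne_zero j p (chart_ext k h.1 h.2)
  -- `L` is the equation, in chart `k`, of the hyperplane missed by chart `j`. Proportionality is
  -- known where `L ≠ 0`; multiplying by `L` makes it global, and `L` cancels.
  obtain ⟨L, hL⟩ : ∃ L : MvPolynomial (Fin n) ℂ, ∀ w, MvPolynomial.eval w L = chartVec k w j := by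
    rcases Fin.eq_self_or_eq_succAbove k j with rfl | ⟨i, rfl⟩
    · exact ⟨1, by simp⟩
    · exact ⟨MvPolynomial.X i, by simp⟩
  have hL0 : L ≠ 0 := by
    rintro rfl
    have := hL fun _ => 1
    rcases Fin.eq_self_or_eq_succAbove k j with rfl | ⟨i, rfl⟩ <;> simp at this
  obtain ⟨b, hb, hbF⟩ := exists_eq_C_mul_of_noCommonFactor (fun i i' => by
    refine mul_left_cancel₀ hL0 (MvPolynomial.funext fun w => ?_)
    simp only [map_mul, map_sub, MvPolynomial.eval_C, MvPolynomial.eval_X, hL]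
    by_cases hw : chartVec k w j = 0
    · simp [hw]
    · obtain ⟨b, hb⟩ := F.exists_polyField_eq_smul_pencilField hF k hw
      have h1 := congrFun hb i
      have h2 := congrFun hb i'
      simp only [polyField, Pi.smul_apply, smul_eq_mul, pencilField] at h1 h2
      rw [h1, h2]
      ring) (F.noCommonFactor k) hnc
  refine ⟨b, hb, fun w => funext fun i => ?_⟩
  simp [polyField, hbF, pencilField]

/-- In every chart the field is a nonzero constant times the pencil field, which vanishes only at
the base point and elsewhere points towards it. -/
theorem isRadialAt_of_polyField_eq (F : ProjFoliation n) (hn : 2 ≤ n) {j : Fin (n + 1)}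
    {p : Fin n → ℂ} {c : ℂ} (hF : ∀ z, polyField (F.field j) z = c • (z - p)) :
    F.IsRadialAt (chartPt j p) := by
  choose b hb hbF using F.exists_polyField_eq_smul_pencilField_of_forall hn hF
  refine ⟨Set.Subset.antisymm ?_ ?_, fun k w _ => ?_⟩
  · rintro m ⟨k, w, rfl, hw⟩
    rw [hbF k w, smul_eq_zero_iff_right (hb k)] at hw
    have hd := chartDir_pencilField k (chartVec j p) w
    have h0 : chartDir k (0 : Fin n → ℂ) = 0 := (chartDirLinear k).map_zero
    rw [hw, h0, eq_comm, sub_eq_zero] at hd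
    exact ((chartPt_eq_iff _ _ _ _).2 ⟨_, hd.symm⟩).symm
  · rintro m rfl
    exact ⟨j, p, rfl, by rw [hF, sub_self, smul_zero]⟩
  · rw [chartPt_submodule, chartPt_submodule, tangentSpan, hbF k w, chartDir_smul,
      chartDir_pencilField, ← Submodule.span_union, Set.singleton_union]
    apply le_antisymm <;> rw [Submodule.span_le, Set.pair_subset_iff]
    · refine ⟨Submodule.subset_span (by simp), ?_⟩
      exact Submodule.mem_span_pair.2 ⟨-(b k * chartVec j p k), b k, by module⟩
    · refine ⟨Submodule.subset_span (by simp), ?_⟩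
      refine Submodule.mem_span_pair.2 ⟨chartVec j p k, (b k)⁻¹, ?_⟩
      rw [smul_smul, inv_mul_cancel₀ (hb k)]
      module

end ProjFoliation

end Projective

end Lemmas

theorem proposition2p6 (n : ℕ) (hn : 2 ≤ n) :
    -- vector fields on a ball
    (∀ (ρ : ℝ), 0 < ρ → ∀ X : EuclideanSpace ℂ (Fin n) → EuclideanSpace ℂ (Fin n),
      DifferentiableOn ℂ X (Metric.ball 0 ρ) →
      IsIsolatedZero X 0 →
      TrajectoriesInLines X (Metric.ball 0 ρ) →
      ∃ u : EuclideanSpace ℂ (Fin n) → ℂ,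
        DifferentiableOn ℂ u (Metric.ball 0 ρ) ∧
        (∀ z ∈ Metric.ball (0 : EuclideanSpace ℂ (Fin n)) ρ, X z = u z • z) ∧
        (∀ z ∈ Metric.ball (0 : EuclideanSpace ℂ (Fin n)) ρ, z = 0 ∨ X z ≠ 0 → u z ≠ 0)) ∧
    -- foliations of affine space
    (∀ (P : Fin n → MvPolynomial (Fin n) ℂ) (p : Fin n → ℂ),
      IsAffineFoliationByLines P →
      IsIsolatedZero (polyField P) p →
      ∃ c : ℂ, c ≠ 0 ∧
        ∀ i, P i = MvPolynomial.C c * (MvPolynomial.X i - MvPolynomial.C (p i))) ∧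
    -- foliations of projective space
    (∀ (F : ProjFoliation n) (p : ℙ ℂ (Fin (n + 1) → ℂ)),
      F.ByLines → F.IsIsolatedSing p → F.IsRadialAt p) := by
  refine ⟨fun ρ hρ X hX h0 hT => exists_eq_smul_of_trajectoriesInLines hn hρ hX h0 hT,
    fun P p hP hp => exists_eq_C_mul_X_sub_C_of_isAffineFoliationByLines hn hP hp, ?_⟩
  rintro F p hF ⟨j, z, rfl, hz⟩
  obtain ⟨c, -, hc⟩ :=
    exists_eq_C_mul_X_sub_C_of_isAffineFoliationByLines hn (hF.isAffineFoliationByLines j) hz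
  refine F.isRadialAt_of_polyField_eq hn (c := c) fun w => funext fun i => ?_
  simp [polyField, hc]
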